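/- Let $X$ be a finite-dimensional real inner product space with closed unit ball $B$, and let $f\colon X\to\mathbb R$ be locally Lipschitz. Let $\partial f(x)$ denote the Clarke subdifferential, that is, the closed convex hull of all limits $\lim_r\nabla f(x_r)$ along sequences $x_r\to x$ of points at which $f$ is differentiable. For $\varepsilon\ge 0$ let $\partial_\varepsilon f(x)=\operatorname{conv}\big(\partial f(x+\varepsilon B)\big)$, where $\partial f(S)=\bigcup_{y\in S}\partial f(y)$; let $g_\varepsilon(x)$ be the shortest vector in $\partial_\varepsilon f(x)$, and define the Goldstein modulus $$\Gamma f(x)=\inf\{\varepsilon\ge 0 : |g_\varepsilon(x)|\le\varepsilon\}.$$ Let $M\subset X$ be a set that is a $C^2$-smooth manifold around a point $\bar x\in M$: near $\bar x$, $M$ is the zero set of a $C^2$ map into some $\mathbb R^k$ whose derivative at $\bar x$ is surjective. Every $x$ near $\bar x$ then has a unique nearest point $P_M(x)$ in $M$; write $d_M(x)$ for the distance from $x$ to $M$. Suppose that $f$ grows robustly relative to $M$ at $\bar x$, that is: 1. (quadratic growth) there is $\delta>0$ with $f(x)-f(\bar x)\ge\frac{\delta}{2}|x-\bar x|^2$ for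 all $x\in X$ near $\bar x$; 2. (regularity) $f$ is subdifferentially regular at every $x\in M$: for all $y\in X$, $\lim_{t\downarrow 0}\frac1t\big(f(x+ty)-f(x)\big)=\max_{v\in\partial f(x)}\langle v,y\rangle$; 3. (smooth restriction) the restriction $f|_M$ is $C^2$-smooth around $\bar x$: near $\bar x$ it agrees on $M$ with a function that is $C^2$ on a neighbourhood of $\bar x$ in $X$; 4. (upper Lipschitz subdifferential) there is $K>0$ such that $\partial f(y)\subset\partial f(x)+K|x-y|B$ for all $x,y$ near $\bar x$ with $x\in M$; 5. (aiming) there is $\mu>0$ such that $\langle v,x-P_M(x)\rangle\ge\mu\, d_M(x)$ for all $x\in X$ near $\bar x$ and all $v\in\partial f(x)$. Then the Goldstein modulus of $f$ grows linearly at $\bar x$: there exists $\alpha>0$ such that $\Gamma f(x)\ge\alpha|x-\bar x|$ for all $x\in X$ near $\bar x$. -/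

import Mathlib

open Filter Topology Metric
open scoped Pointwise

section GoldsteinDefs

variable {X : Type*} [NormedAddCommGroup X] [InnerProductSpace ℝ X]

section Subdifferential

variable [FiniteDimensional ℝ X]

/-- All limits of gradients `∇ f (u r)` along sequences `u r → x` of points where `f` is
differentiable. -/
def limitingGradients (f : X → ℝ) (x : X) : Set X :=
  haveI : CompleteSpace X := FiniteDimensional.complete ℝ X
  {v | ∃ u g : ℕ → X, Tendsto u atTop (𝓝 x) ∧ (∀ r, HasGradientAt f (g r) (u r)) ∧
    Tendsto g atTop (𝓝 v)}

/-- The Clarke subdifferential `∂f(x)`: the closed convex hull of the limiting gradients. -/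
def clarkeSubdifferential (f : X → ℝ) (x : X) : Set X :=
  closure (convexHull ℝ (limitingGradients f x))

/-- The Goldstein subdifferential `∂_ε f(x) = conv (∂f(x + εB))`. -/
def goldsteinSubdifferential (f : X → ℝ) (ε : ℝ) (x : X) : Set X :=
  convexHull ℝ (⋃ y ∈ closedBall x ε, clarkeSubdifferential f y)

/-- `g` is the Goldstein subgradient `g_ε(x)`: the shortest vector of `∂_ε f(x)`. -/
def IsGoldsteinSubgradient (f : X → ℝ) (ε : ℝ) (x g : X) : Prop :=
  g ∈ goldsteinSubdifferential f ε x ∧ ∀ v ∈ goldsteinSubdifferential f ε x, ‖g‖ ≤ ‖v‖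

/-- The Goldstein modulus `Γf(x) = inf {ε ≥ 0 : |g_ε(x)| ≤ ε}`. -/
noncomputable def goldsteinModulus (f : X → ℝ) (x : X) : ℝ :=
  sInf {ε : ℝ | 0 ≤ ε ∧ ∃ g, IsGoldsteinSubgradient f ε x g ∧ ‖g‖ ≤ ε}

/-- The Goldstein modulus of `f` grows linearly at `xbar`. -/
def GoldsteinModulusGrowsLinearly (f : X → ℝ) (xbar : X) : Prop :=
  ∃ α : ℝ, 0 < α ∧ ∀ᶠ x in 𝓝 xbar, α * ‖x - xbar‖ ≤ goldsteinModulus f x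

/-- The Clarke directional derivative `f°(x; y) = max {⟪v, y⟫ : v ∈ ∂f(x)}`. For locally Lipschitz
`f` the set `∂f(x)` is nonempty and compact, so the supremum is a maximum. -/
noncomputable def clarkeDirDeriv (f : X → ℝ) (x y : X) : ℝ :=
  sSup ((fun v : X => inner ℝ v y) '' clarkeSubdifferential f x)

/-- Subdifferential regularity: the one-sided classical directional derivative exists and equals
the Clarke directional derivative, in every direction. -/
def SubdifferentiallyRegularAt (f : X → ℝ) (x : X) : Prop :=
  ∀ y : X, Tendsto (fun t : ℝ => (1 / t) * (f (x + t • y) - f x)) (𝓝[>] 0)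
    (𝓝 (clarkeDirDeriv f x y))

/-- `∂f` is upper Lipschitz relative to `M` at `xbar`: for some `K > 0`, all points `x, y` near
`xbar` with `x ∈ M` satisfy `∂f(y) ⊆ ∂f(x) + K|x - y|B`. -/
def SubdifferentialUpperLipschitz (f : X → ℝ) (M : Set X) (xbar : X) : Prop :=
  ∃ K : ℝ, 0 < K ∧ ∃ U ∈ 𝓝 xbar, ∀ x ∈ U ∩ M, ∀ y ∈ U,
    clarkeSubdifferential f y ⊆ clarkeSubdifferential f x + closedBall (0 : X) (K * ‖x - y‖)

/-- `p` is a nearest point to `x` in `M`. -/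
def IsNearestPoint (M : Set X) (x p : X) : Prop :=
  p ∈ M ∧ dist x p = infDist x M

/-- The aiming condition relative to `M` at `xbar`. When `M` is a `C²` manifold around `xbar`,
every `x` near `xbar` has exactly one nearest point `p = P_M(x)` in `M`. -/
def AimingCondition (f : X → ℝ) (M : Set X) (xbar : X) : Prop :=
  ∃ μ : ℝ, 0 < μ ∧ ∀ᶠ x in 𝓝 xbar, ∀ p, IsNearestPoint M x p →
    ∀ v ∈ clarkeSubdifferential f x, μ * infDist x M ≤ inner ℝ v (x - p)

end Subdifferential

/-- `f` grows quadratically at `xbar`. -/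
def GrowsQuadratically (f : X → ℝ) (xbar : X) : Prop :=
  ∃ δ : ℝ, 0 < δ ∧ ∀ᶠ x in 𝓝 xbar, δ / 2 * ‖x - xbar‖ ^ 2 ≤ f x - f xbar

/-- `M` is a `C²`-smooth (embedded) manifold around `xbar ∈ M`: near `xbar` it is the zero set of
a `C²` map into some `ℝᵏ` whose derivative at `xbar` is surjective. -/
def IsC2ManifoldAround (M : Set X) (xbar : X) : Prop :=
  xbar ∈ M ∧ ∃ (k : ℕ) (F : X → EuclideanSpace ℝ (Fin k)),
    ContDiffAt ℝ 2 F xbar ∧ Function.Surjective (fderiv ℝ F xbar) ∧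
    ∀ᶠ x in 𝓝 xbar, (x ∈ M ↔ F x = 0)

/-- The restriction of `f` to `M` is `C²`-smooth around `xbar`: near `xbar` it agrees on `M` with
a function that is `C²` on a neighbourhood of `xbar` in the ambient space. -/
def RestrictionC2Around (f : X → ℝ) (M : Set X) (xbar : X) : Prop :=
  ∃ h : X → ℝ, ContDiffAt ℝ 2 h xbar ∧ ∀ᶠ x in 𝓝[M] xbar, f x = h x

/-- `f` grows robustly relative to `M` at `xbar` (for `f` locally Lipschitz and `M` a `C²` manifold
around `xbar`). -/
structure GrowsRobustly [FiniteDimensional ℝ X] (f : X → ℝ) (M : Set X) (xbar : X) : Prop where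
  quadratic_growth : GrowsQuadratically f xbar
  regular : ∀ x ∈ M, SubdifferentiallyRegularAt f x
  smooth_restriction : RestrictionC2Around f M xbar
  upper_lipschitz : SubdifferentialUpperLipschitz f M xbar
  aiming : AimingCondition f M xbar

end GoldsteinDefs

/-!
Every element of `∂_ε f(x)` with `ε < |x - xbar|` is a convex combination of Clarke subgradients at
points `y` with `|y - x| ≤ ε`. Two regimes have to be compared, according to the ratio of `ε` to the
distance from `x` to `M`.

If `ε < c d_M(x)` for a small constant `c`, let `p` be a nearest point of `x` in `M`. Nearest points
of `x` and `y` differ by at most `|x - y|` plus a small multiple of `d_M(x) + d_M(y)`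
(`IsStraightening.exists_norm_sub_le`), so the aiming condition at each `y` gives
`⟪v, x - p⟫ ≥ (μ / 2) d_M(x)` for all the subgradients `v` at once. This survives convex
combinations, and Goldstein subgradients are bounded away from `0`
(`GrowsRobustly.exists_norm_goldstein_ge`).

If `ε ≥ c d_M(x)`, then all points `y` lie within a multiple of `ε` of `p ∈ M`, and the upper
Lipschitz condition places `∂_ε f(x)` within a multiple of `ε` of the convex set `∂f(p)`. All
elements of `∂f(p)` have norm at least `β |p - xbar|`
(`GrowsRobustly.exists_norm_subgradient_ge`): the manifold is straightened by a `C²` change of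
coordinates `Φ`, quadratic growth makes the radial derivative of `f ∘ Φ` along the straightened
manifold at least a multiple of `|u|²`, and regularity turns this into a lower bound for
subgradients. So `|g| ≤ ε` forces `|x - xbar| ≤ C ε` (`GrowsRobustly.exists_norm_sub_le_mul`).

The infimum defining the Goldstein modulus is over a nonempty set because `xbar` is Clarke critical
(`zero_mem_clarkeSubdifferential`).
-/

/-! ### Clarke subgradients of Lipschitz functions -/

section Clarke

variable {X : Type*} [NormedAddCommGroup X] [InnerProductSpace ℝ X] [FiniteDimensional ℝ X]

theorem convex_clarkeSubdifferential (f : X → ℝ) (x : X) : Convex ℝ (clarkeSubdifferential f x) :=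
  (convex_convexHull ℝ _).closure

theorem norm_le_of_mem_limitingGradients {f : X → ℝ} {L : NNReal} {t : Set X}
    (hf : LipschitzOnWith L f t) {x v : X} (ht : t ∈ 𝓝 x) (hv : v ∈ limitingGradients f x) :
    ‖v‖ ≤ L := by
  have : CompleteSpace X := FiniteDimensional.complete ℝ X
  obtain ⟨u, g, hu, hg, hgv⟩ := hv
  refine le_of_tendsto hgv.norm ?_
  filter_upwards [hu.eventually (eventually_mem_nhds_iff.2 ht)] with r hr
  simpa using (hg r).hasFDerivAt.le_of_lipschitzOn hr hf

theorem norm_le_of_mem_clarkeSubdifferential {f : X → ℝ} {L : NNReal} {t : Set X}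
    (hf : LipschitzOnWith L f t) {x v : X} (ht : t ∈ 𝓝 x) (hv : v ∈ clarkeSubdifferential f x) :
    ‖v‖ ≤ L := by
  have h : clarkeSubdifferential f x ⊆ closedBall 0 L :=
    closure_minimal (convexHull_min (fun w hw => by
      simpa using norm_le_of_mem_limitingGradients hf ht hw) (convex_closedBall _ _))
      isClosed_closedBall
  simpa using h hv

/-- By Rademacher's theorem the points of differentiability are dense, and the gradients there
are bounded, so they have a limit point. -/
theorem clarkeSubdifferential_nonempty {f : X → ℝ} (hf : LocallyLipschitz f) (x : X) :
    (clarkeSubdifferential f x).Nonempty := by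
  have : CompleteSpace X := FiniteDimensional.complete ℝ X
  obtain ⟨L, t, ht, hL⟩ := hf x
  let : MeasurableSpace X := borel X
  have : BorelSpace X := ⟨rfl⟩
  have hae := hL.ae_differentiableWithinAt_of_mem (μ := MeasureTheory.Measure.addHaar)
  have hd : Dense {y | y ∈ t → DifferentiableWithinAt ℝ f t y} :=
    MeasureTheory.Measure.dense_of_ae hae
  have key : ∀ n : ℕ, ∃ y ∈ ball x (1 / (n + 1 : ℝ)) ∩ interior t, DifferentiableAt ℝ f y := by
    intro n
    have hn : (0 : ℝ) < 1 / (n + 1 : ℝ) := by positivity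
    obtain ⟨y, hy, hy'⟩ := hd.inter_open_nonempty _ (isOpen_ball.inter isOpen_interior)
      ⟨x, mem_ball_self hn, mem_interior_iff_mem_nhds.2 ht⟩
    have hyt := mem_interior_iff_mem_nhds.1 hy.2
    exact ⟨y, hy, (hy' (mem_of_mem_nhds hyt)).differentiableAt hyt⟩
  choose u hu hdiff using key
  have hux : Tendsto u atTop (𝓝 x) := by
    rw [tendsto_iff_dist_tendsto_zero]
    exact squeeze_zero (fun _ => dist_nonneg) (fun n => (mem_ball.1 (hu n).1).le)
      tendsto_one_div_add_atTop_nhds_zero_nat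
  have hgb : ∀ n, gradient f (u n) ∈ closedBall (0 : X) L := fun n => by
    have h := (hdiff n).hasGradientAt.hasFDerivAt.le_of_lipschitzOn
      (mem_interior_iff_mem_nhds.1 (hu n).2) hL
    rw [LinearIsometryEquiv.norm_map] at h
    simpa using h
  obtain ⟨v, -, φ, hφ, hv⟩ := (isCompact_closedBall (0 : X) L).tendsto_subseq hgb
  exact ⟨v, subset_closure (subset_convexHull ℝ _ ⟨u ∘ φ, fun n => gradient f (u (φ n)),
    hux.comp hφ.tendsto_atTop, fun n => (hdiff _).hasGradientAt, hv⟩)⟩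

theorem inner_le_clarkeDirDeriv {f : X → ℝ} (hf : LocallyLipschitz f) {x v : X}
    (hv : v ∈ clarkeSubdifferential f x) (y : X) : inner ℝ v y ≤ clarkeDirDeriv f x y := by
  obtain ⟨L, t, ht, hL⟩ := hf x
  refine le_csSup ⟨L * ‖y‖, ?_⟩ ⟨v, hv, rfl⟩
  rintro _ ⟨w, hw, rfl⟩
  exact (real_inner_le_norm w y).trans
    (mul_le_mul_of_nonneg_right (norm_le_of_mem_clarkeSubdifferential hL ht hw) (norm_nonneg _))

/-- A regular local minimizer is Clarke critical: its directional derivatives, which are the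
support function of `∂f(x)`, are nonnegative, so no hyperplane separates `0` from `∂f(x)`. -/
theorem zero_mem_clarkeSubdifferential {f : X → ℝ} (hf : LocallyLipschitz f) {x : X}
    (hreg : SubdifferentiallyRegularAt f x) (hmin : IsLocalMin f x) :
    (0 : X) ∈ clarkeSubdifferential f x := by
  have : CompleteSpace X := FiniteDimensional.complete ℝ X
  by_contra h0
  obtain ⟨l, a, hl, hla⟩ := geometric_hahn_banach_point_closed
    (convex_clarkeSubdifferential f x) isClosed_closure h0
  rw [map_zero] at hl
  set y : X := -(InnerProductSpace.toDual ℝ X).symm l with hy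
  have hle : clarkeDirDeriv f x y ≤ -a := by
    refine csSup_le ((clarkeSubdifferential_nonempty hf x).image _) ?_
    rintro _ ⟨v, hv, rfl⟩
    have : inner ℝ v y = - l v := by
      rw [hy, inner_neg_right, real_inner_comm, InnerProductSpace.toDual_symm_apply]
    simp only [this]
    linarith [hla v hv]
  have hge : 0 ≤ clarkeDirDeriv f x y := by
    refine ge_of_tendsto (hreg y) ?_
    have hc : Tendsto (fun t : ℝ => x + t • y) (𝓝[>] 0) (𝓝 x) := by
      have : ContinuousAt (fun t : ℝ => x + t • y) 0 := by fun_prop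
      simpa using this.tendsto.mono_left nhdsWithin_le_nhds
    filter_upwards [hc.eventually hmin, self_mem_nhdsWithin] with t ht ht0
    have ht0 : (0 : ℝ) < t := ht0
    exact mul_nonneg (by positivity) (sub_nonneg.2 ht)
  linarith

end Clarke

/-! ### Straightening a manifold -/

section Chart

variable {X : Type*} [NormedAddCommGroup X] [InnerProductSpace ℝ X] [FiniteDimensional ℝ X]

/-- `G` straightens `M` near `xbar` to the linear subspace `E` near `0`, and `Φ` is its local
inverse. Both have derivative the identity at their base points. Only the properties needed are
recorded: `C²` smoothness of `Φ`, strict differentiability of `G`, and one of the two inverse laws,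
stated for germs since nothing is controlled away from the base points. -/
structure IsStraightening (M : Set X) (xbar : X) (E : Submodule ℝ X) (G Φ : X → X) : Prop where
  map_base : G xbar = 0
  symm_zero : Φ 0 = xbar
  contDiffAt_symm : ContDiffAt ℝ 2 Φ 0
  strict : HasStrictFDerivAt G (ContinuousLinearMap.id ℝ X) xbar
  strict_symm : HasStrictFDerivAt Φ (ContinuousLinearMap.id ℝ X) 0
  left_inv : ∀ᶠ x in 𝓝 xbar, Φ (G x) = x
  map_mem : ∀ᶠ x in 𝓝 xbar, x ∈ M → G x ∈ E
  symm_mem : ∀ᶠ v in 𝓝 0, v ∈ E → Φ v ∈ M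

/-- If `M = {F = 0}`, `A` is the derivative of `F` at `xbar` and `R` is a right inverse of `A`, then
`G x = R (F x) + (x - xbar) - R (A (x - xbar))` has derivative `1` at `xbar`, and `A (G x) = F x`. -/
theorem IsC2ManifoldAround.exists_isStraightening {M : Set X} {xbar : X}
    (hM : IsC2ManifoldAround M xbar) : ∃ E G Φ, IsStraightening M xbar E G Φ := by
  have : CompleteSpace X := FiniteDimensional.complete ℝ X
  obtain ⟨hx, k, F, hF, hsurj, hMF⟩ := hM
  set A := fderiv ℝ F xbar with hA
  obtain ⟨R, hR⟩ := A.exists_rightInverse_of_surjective (LinearMap.range_eq_top.2 hsurj)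
  have hAR : ∀ z, A (R z) = z := fun z => by
    simpa using DFunLike.congr_fun hR z
  have hFx : F xbar = 0 := hMF.self_of_nhds.1 hx
  set G : X → X := fun x => R (F x) + (x - xbar) - R (A (x - xbar)) with hG
  have hGc : ContDiffAt ℝ 2 G xbar :=
    ((R.contDiff.contDiffAt.comp xbar hF).add (contDiffAt_id.sub contDiffAt_const)).sub
      (R.contDiff.contDiffAt.comp xbar (A.contDiff.contDiffAt.comp xbar
        (contDiffAt_id.sub contDiffAt_const)))
  have hFd : HasFDerivAt F A xbar := (hF.differentiableAt (by norm_num)).hasFDerivAt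
  have hGd : HasFDerivAt G
      ((ContinuousLinearEquiv.refl ℝ X : X ≃L[ℝ] X) : X →L[ℝ] X) xbar := by
    have hs : HasFDerivAt (fun x : X => x - xbar) (ContinuousLinearMap.id ℝ X) xbar :=
      (hasFDerivAt_id xbar).sub_const xbar
    have h := ((R.hasFDerivAt.comp xbar hFd).add hs).sub
      (R.hasFDerivAt.comp xbar (A.hasFDerivAt.comp xbar hs))
    refine h.congr_fderiv ?_
    ext z
    simp
  have hGs := hGc.hasStrictFDerivAt' hGd (by norm_num)
  have hG0 : G xbar = 0 := by simp [hG, hFx]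
  have hAG : ∀ x, A (G x) = F x := fun x => by simp [hG, map_add, map_sub, hAR]
  have hΦ0 : hGc.localInverse hGd (by norm_num) 0 = xbar := by
    have := hGc.localInverse_apply_image hGd (by norm_num)
    rwa [hG0] at this
  have hΦs : HasStrictFDerivAt (hGc.localInverse hGd (by norm_num))
      (ContinuousLinearMap.id ℝ X) 0 := by
    have := hGs.to_localInverse
    rw [hG0] at this
    exact this
  refine ⟨A.ker, G, hGc.localInverse hGd (by norm_num), hG0, hΦ0, ?_, hGs,
    hΦs, hGs.eventually_left_inverse, ?_, ?_⟩
  · have := hGc.to_localInverse hGd (by norm_num)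
    rwa [hG0] at this
  · filter_upwards [hMF] with x hx hxM
    simpa [hAG] using hx.1 hxM
  · have hr := hGs.eventually_right_inverse
    rw [hG0] at hr
    have ht := hΦs.continuousAt.tendsto
    rw [hΦ0] at ht
    filter_upwards [hr, ht.eventually hMF] with v hv hv' hvE
    rw [hv', ← hAG]
    have hv : G (hGc.localInverse hGd (by norm_num) v) = v := hv
    rw [hv]
    simpa using hvE

end Chart

/-- A map with strict derivative `1` is, near the base point, a small Lipschitz perturbation of the
identity. -/
theorem HasStrictFDerivAt.exists_forall_norm_sub_le {X : Type*} [NormedAddCommGroup X]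
    [NormedSpace ℝ X] {G : X → X} {a : X}
    (hG : HasStrictFDerivAt G (ContinuousLinearMap.id ℝ X) a) {η : ℝ} (hη : 0 < η) :
    ∃ r > 0, ∀ x ∈ ball a r, ∀ y ∈ ball a r, ‖G x - G y - (x - y)‖ ≤ η * ‖x - y‖ := by
  have h := hG.isLittleO.def hη
  rw [nhds_prod_eq] at h
  obtain ⟨s, hs, h⟩ := eventually_prod_self_iff'.1 h
  obtain ⟨r, hr, hrs⟩ := Metric.mem_nhds_iff.1 hs
  exact ⟨r, hr, fun x hx y hy => h x (hrs hx) y (hrs hy)⟩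

/-! ### Nearest points -/

section Nearest

variable {X : Type*} [NormedAddCommGroup X]

theorem IsNearestPoint.dist_le {M : Set X} {x p q : X} (h : IsNearestPoint M x p) (hq : q ∈ M) :
    dist x p ≤ dist x q :=
  h.2.trans_le (infDist_le_dist_of_mem hq)

theorem IsNearestPoint.norm_sub_eq {M : Set X} {x p : X} (h : IsNearestPoint M x p) :
    ‖x - p‖ = infDist x M := by
  rw [← dist_eq_norm, h.2]

theorem IsNearestPoint.dist_le_two_mul {M : Set X} {x p q : X} (h : IsNearestPoint M x p)
    (hq : q ∈ M) : dist p q ≤ 2 * dist x q := by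
  have h1 := h.dist_le hq
  have h2 := dist_triangle_left p q x
  linarith

variable [InnerProductSpace ℝ X]

theorem IsC2ManifoldAround.exists_isClosed_inter {M : Set X} {xbar : X}
    (hM : IsC2ManifoldAround M xbar) : ∃ r > 0, IsClosed (closedBall xbar r ∩ M) := by
  obtain ⟨-, k, F, hF, -, hMF⟩ := hM
  have hFc : ∀ᶠ x in 𝓝 xbar, ContinuousAt F x :=
    (hF.eventually (by simp)).mono fun x hx => hx.continuousAt
  obtain ⟨r, hr, h⟩ := Metric.nhds_basis_closedBall.eventually_iff.1 (hMF.and hFc)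
  refine ⟨r, hr, ?_⟩
  have he : closedBall xbar r ∩ M = closedBall xbar r ∩ F ⁻¹' {0} :=
    Set.ext fun x => and_congr_right fun hx => (h hx).1
  rw [he]
  exact ContinuousOn.preimage_isClosed_of_isClosed
    (fun x hx => (h hx).2.continuousWithinAt) isClosed_closedBall isClosed_singleton

/-- A manifold is locally closed, hence locally compact, and points of `M` far from `xbar` do not
compete for the nearest point. -/
theorem IsC2ManifoldAround.eventually_exists_isNearestPoint [FiniteDimensional ℝ X] {M : Set X}
    {xbar : X} (hM : IsC2ManifoldAround M xbar) :
    ∀ᶠ x in 𝓝 xbar, ∃ p, IsNearestPoint M x p := by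
  obtain ⟨r, hr, hcl⟩ := hM.exists_isClosed_inter
  have hK : IsCompact (closedBall xbar r ∩ M) :=
    (isCompact_closedBall xbar r).of_isClosed_subset hcl Set.inter_subset_left
  have hxK : xbar ∈ closedBall xbar r ∩ M := ⟨mem_closedBall_self hr.le, hM.1⟩
  filter_upwards [ball_mem_nhds xbar (half_pos hr)] with x hx
  obtain ⟨p, hp, hpd⟩ := hK.exists_infDist_eq_dist ⟨_, hxK⟩ x
  refine ⟨p, hp.2, le_antisymm ((le_infDist ⟨_, hM.1⟩).2 fun m hm => ?_)
    (infDist_le_dist_of_mem hp.2)⟩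
  rw [← hpd]
  by_cases hmr : m ∈ closedBall xbar r
  · exact infDist_le_dist_of_mem ⟨hmr, hm⟩
  · refine (infDist_le_dist_of_mem hxK).trans ?_
    rw [mem_closedBall, not_le] at hmr
    rw [mem_ball] at hx
    have := dist_triangle_left m xbar x
    linarith

/-- Displacements to nearest points are almost normal to the manifold: moving from `p` along the
image of a segment in the chart cannot decrease the distance to `x`. -/
theorem IsStraightening.exists_inner_le {M : Set X} {xbar : X} {E : Submodule ℝ X} {G Φ : X → X}
    (h : IsStraightening M xbar E G Φ) {η : ℝ} (hη : 0 < η) :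
    ∃ r > 0, ∀ x p q : X, p ∈ ball xbar r → q ∈ ball xbar r → q ∈ M → IsNearestPoint M x p →
      inner ℝ (x - p) (q - p) ≤ η * ‖x - p‖ * ‖q - p‖ := by
  -- `κ ≤ 1 / 2` keeps `Φ` bi-Lipschitz with constant `2`; `κ ≤ η / 4` absorbs that constant.
  set κ := min (1 / 2) (η / 4) with hκ
  have hκ0 : 0 < κ := by positivity
  have hκ1 : κ ≤ 1 / 2 := min_le_left _ _
  have hκ2 : κ ≤ η / 4 := min_le_right _ _
  obtain ⟨ρ, hρ, hΦ⟩ := h.strict_symm.exists_forall_norm_sub_le hκ0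
  obtain ⟨σ, hσ, hM⟩ := Metric.eventually_nhds_iff_ball.1 h.symm_mem
  have hGt : Tendsto G (𝓝 xbar) (𝓝 0) := by
    simpa [h.map_base] using h.strict.continuousAt.tendsto
  obtain ⟨r, hr, hG⟩ := Metric.eventually_nhds_iff_ball.1
    ((hGt.eventually (ball_mem_nhds 0 (lt_min hρ hσ))).and (h.left_inv.and h.map_mem))
  refine ⟨r, hr, fun x p q hp hq hqM hpx => ?_⟩
  obtain ⟨hpB, hpinv, hpE⟩ := hG p hp
  obtain ⟨hqB, hqinv, hqE⟩ := hG q hq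
  set w := G q - G p with hw
  set z := x - p with hz
  have hρB : ∀ v ∈ ball (0 : X) (min ρ σ), v ∈ ball (0 : X) ρ :=
    fun v hv => ball_subset_ball (min_le_left _ _) hv
  have hqp : ‖q - p - w‖ ≤ κ * ‖w‖ := by
    have := hΦ _ (hρB _ hqB) _ (hρB _ hpB)
    rwa [hqinv, hpinv] at this
  have hwq : ‖w‖ ≤ 2 * ‖q - p‖ := by
    have h1 : ‖w‖ ≤ ‖q - p‖ + ‖q - p - w‖ := by
      have := norm_sub_le (q - p) (q - p - w)
      simpa using this
    have h2 : κ * ‖w‖ ≤ 1 / 2 * ‖w‖ := mul_le_mul_of_nonneg_right hκ1 (norm_nonneg _)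
    linarith
  -- the first-order condition along the curve `s ↦ Φ (G p + s • w)`, before letting `s → 0`
  have hstep : ∀ s ∈ Set.Ioc (0 : ℝ) 1,
      inner ℝ z w ≤ κ * ‖w‖ * ‖z‖ + s * (2 * ‖w‖ ^ 2) := by
    intro s hs
    have hmem : G p + s • w ∈ ball (0 : X) (min ρ σ) :=
      (convex_ball (0 : X) (min ρ σ)).add_smul_sub_mem hpB hqB ⟨hs.1.le, hs.2⟩
    have hγM : Φ (G p + s • w) ∈ M := hM _ (ball_subset_ball (min_le_right _ _) hmem)
      (E.add_mem (hpE hpx.1) (E.smul_mem s (E.sub_mem (hqE hqM) (hpE hpx.1))))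
    set e := Φ (G p + s • w) - p - s • w with he
    have hee : ‖e‖ ≤ κ * (s * ‖w‖) := by
      have := hΦ _ (hρB _ hmem) _ (hρB _ hpB)
      rw [hpinv, add_sub_cancel_left, norm_smul, Real.norm_of_nonneg hs.1.le] at this
      exact this
    have hxs : x - Φ (G p + s • w) = z - (s • w + e) := by rw [he, hz]; abel
    have hd := hpx.dist_le hγM
    rw [dist_eq_norm, dist_eq_norm, hxs, ← hz] at hd
    have hsq := pow_le_pow_left₀ (norm_nonneg _) hd 2
    rw [norm_sub_sq_real z] at hsq
    have hse : ‖s • w + e‖ ≤ 2 * s * ‖w‖ := by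
      refine (norm_add_le _ _).trans ?_
      rw [norm_smul, Real.norm_of_nonneg hs.1.le]
      have h0 : 0 ≤ s * ‖w‖ := mul_nonneg hs.1.le (norm_nonneg _)
      nlinarith
    have hse2 := pow_le_pow_left₀ (norm_nonneg _) hse 2
    have hze : -(inner ℝ z e) ≤ ‖z‖ * (κ * (s * ‖w‖)) := by
      have h1 := neg_le_of_abs_le (abs_real_inner_le_norm z e)
      have h2 := mul_le_mul_of_nonneg_left hee (norm_nonneg z)
      linarith
    rw [inner_add_right, real_inner_smul_right] at hsq
    refine le_of_mul_le_mul_left ?_ hs.1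
    nlinarith
  have hlim : inner ℝ z w ≤ κ * ‖w‖ * ‖z‖ := by
    have ht : Tendsto (fun s : ℝ => κ * ‖w‖ * ‖z‖ + s * (2 * ‖w‖ ^ 2)) (𝓝[>] 0)
        (𝓝 (κ * ‖w‖ * ‖z‖ + 0 * (2 * ‖w‖ ^ 2))) :=
      ((continuous_const.add (continuous_id.mul continuous_const)).tendsto 0).mono_left
        nhdsWithin_le_nhds
    rw [zero_mul, add_zero] at ht
    exact ge_of_tendsto ht (eventually_of_mem (Ioc_mem_nhdsGT one_pos) hstep)
  have hsplit : inner ℝ z (q - p) ≤ 2 * (κ * ‖w‖ * ‖z‖) := by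
    have h1 : inner ℝ z (q - p) = inner ℝ z w + inner ℝ z (q - p - w) := by
      rw [← inner_add_right]; simp
    have h2 := real_inner_le_norm z (q - p - w)
    have h3 := mul_le_mul_of_nonneg_left hqp (norm_nonneg z)
    linarith
  have h4 : κ * ‖w‖ ≤ η / 4 * (2 * ‖q - p‖) := mul_le_mul hκ2 hwq (norm_nonneg _) (by positivity)
  have h5 := mul_le_mul_of_nonneg_right h4 (norm_nonneg z)
  nlinarith

/-- Nearest points are almost Lipschitz with constant `1`, the error being small relative to the
distances to `M`. -/
theorem IsStraightening.exists_norm_sub_le {M : Set X} {xbar : X} {E : Submodule ℝ X} {G Φ : X → X}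
    (h : IsStraightening M xbar E G Φ) {η : ℝ} (hη : 0 < η) :
    ∃ r > 0, ∀ x y p q : X, p ∈ ball xbar r → q ∈ ball xbar r → IsNearestPoint M x p →
      IsNearestPoint M y q → ‖q - p‖ ≤ η * (infDist x M + infDist y M) + ‖y - x‖ := by
  obtain ⟨r, hr, H⟩ := h.exists_inner_le hη
  refine ⟨r, hr, fun x y p q hp hq hpx hqy => ?_⟩
  have h1 := H x p q hp hq hqy.1 hpx
  have h2 := H y q p hq hp hpx.1 hqy
  rw [← hpx.norm_sub_eq, ← hqy.norm_sub_eq]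
  rw [norm_sub_rev p q] at h2
  have h3 := real_inner_le_norm (y - x) (q - p)
  have h4 : inner ℝ (q - p) (q - p)
      = inner ℝ (x - p) (q - p) + inner ℝ (y - q) (p - q) + inner ℝ (y - x) (q - p) := by
    rw [← neg_sub q p, inner_neg_right, ← sub_eq_add_neg, ← inner_sub_left, ← inner_add_left]
    congr 1
    abel
  rw [real_inner_self_eq_norm_sq] at h4
  rcases (norm_nonneg (q - p)).eq_or_lt with h0 | h0
  · rw [← h0]; positivity
  · refine le_of_mul_le_mul_right ?_ h0
    nlinarith

end Nearest

/-! ### Subgradients at points of the manifold -/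

/-- Second-order growth of a `C²` function along a subspace forces its radial derivative to grow
quadratically: integrating `k' (t u) u = t k''(0) u u + o(|u|²)` over `[0, 1]` bounds `k''(0) u u`
from below by twice the growth of `k`. -/
theorem ContDiffAt.eventually_le_fderiv_of_growth {V : Type*} [NormedAddCommGroup V]
    [NormedSpace ℝ V] {k : V → ℝ} (hk : ContDiffAt ℝ 2 k 0) {E : Submodule ℝ V} {c : ℝ}
    (hc : 0 < c) (hgrow : ∀ᶠ v in 𝓝 0, v ∈ E → c * ‖v‖ ^ 2 ≤ k v - k 0) :
    ∀ᶠ u in 𝓝 0, u ∈ E → c * ‖u‖ ^ 2 ≤ fderiv ℝ k u u := by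
  have hk1 : ContDiffAt ℝ 1 (fderiv ℝ k) 0 := hk.fderiv_right (by norm_num)
  set B := fderiv ℝ (fderiv ℝ k) 0 with hB
  have hBd : HasFDerivAt (fderiv ℝ k) B 0 := (hk1.differentiableAt (by norm_num)).hasFDerivAt
  have hlo := hBd.isLittleO.def (half_pos hc)
  have hdiff : ∀ᶠ v in 𝓝 (0 : V), DifferentiableAt ℝ k v :=
    (hk.eventually (by simp)).mono fun v hv => hv.differentiableAt (by norm_num)
  obtain ⟨r, hr, H⟩ := Metric.eventually_nhds_iff_ball.1 (hlo.and (hdiff.and hgrow))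
  filter_upwards [ball_mem_nhds 0 hr] with u hu huE
  have hline : ∀ t : ℝ, HasDerivAt (fun s : ℝ => s • u) u t := fun t => by
    simpa using (hasDerivAt_id t).smul_const u
  -- Growth makes `0` a minimizer of `k` along the line through `u`, though not on all of `V`.
  have hcrit : fderiv ℝ k 0 u = 0 := by
    have hd : HasDerivAt (fun s : ℝ => k (s • u)) (fderiv ℝ k 0 u) 0 := by
      have h0 : HasFDerivAt k (fderiv ℝ k 0) ((0 : ℝ) • u) := by
        rw [zero_smul]; exact hdiff.self_of_nhds.hasFDerivAt
      exact h0.comp_hasDerivAt 0 (hline 0)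
    refine IsLocalMin.hasDerivAt_eq_zero ?_ hd
    have ht : Tendsto (fun s : ℝ => s • u) (𝓝 0) (𝓝 0) := by
      simpa using (hline 0).continuousAt.tendsto
    filter_upwards [ht.eventually hgrow] with s hs
    rw [zero_smul]
    nlinarith [hs (E.smul_mem s huE), sq_nonneg ‖s • u‖]
  have hseg : ∀ t ∈ Set.Icc (0 : ℝ) 1, t • u ∈ ball (0 : V) r := fun t ht => by
    rw [mem_ball_zero_iff] at hu ⊢
    rw [norm_smul, Real.norm_of_nonneg ht.1]
    nlinarith [ht.2, norm_nonneg u]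
  have herr : ∀ t ∈ Set.Icc (0 : ℝ) 1,
      |fderiv ℝ k (t • u) u - t * B u u| ≤ t * (c / 2 * ‖u‖ ^ 2) := by
    intro t ht
    have h1 := (H _ (hseg t ht)).1
    rw [sub_zero, norm_smul, Real.norm_of_nonneg ht.1] at h1
    have h2 := ContinuousLinearMap.le_of_opNorm_le _ h1 u
    have h3 : (fderiv ℝ k (t • u) - fderiv ℝ k 0 - B (t • u)) u
        = fderiv ℝ k (t • u) u - t * B u u := by
      simp [hcrit]
    rw [h3, Real.norm_eq_abs] at h2
    linarith
  -- `s ^ 2 / 2 * C` dominates `k (s • u) - k 0` on `[0, 1]`, since its derivative dominates.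
  set C := B u u + c / 2 * ‖u‖ ^ 2 with hC
  have hder : ∀ t ∈ Set.Icc (0 : ℝ) 1, HasDerivAt (fun s : ℝ => k (s • u) - s ^ 2 / 2 * C)
      (fderiv ℝ k (t • u) u - t * C) t := by
    intro t ht
    have h1 := ((H _ (hseg t ht)).2.1.hasFDerivAt).comp_hasDerivAt t (hline t)
    have h2 := (((hasDerivAt_id t).pow 2).div_const 2).mul_const C
    refine (h1.sub h2).congr_deriv ?_
    simp
  have hanti : AntitoneOn (fun s : ℝ => k (s • u) - s ^ 2 / 2 * C) (Set.Icc 0 1) := by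
    refine antitoneOn_of_deriv_nonpos (convex_Icc _ _)
      (fun t ht => (hder t ht).continuousAt.continuousWithinAt)
      (fun t ht => (hder t (interior_subset ht)).differentiableAt.differentiableWithinAt) ?_
    intro t ht
    have ht' := interior_subset ht
    rw [(hder t ht').deriv]
    have := (abs_le.1 (herr t ht')).2
    rw [hC]
    linarith
  have h01 := hanti (Set.left_mem_Icc.2 zero_le_one) (Set.right_mem_Icc.2 zero_le_one) zero_le_one
  have hg := (H u hu).2.2 huE
  have he := (abs_le.1 (herr 1 (Set.right_mem_Icc.2 zero_le_one))).1
  simp only [one_smul, zero_smul] at h01 he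
  linarith

/-- For a locally Lipschitz function, directional derivatives may be computed along any curve with
the given velocity. -/
theorem LocallyLipschitz.tendsto_slope_of_hasDerivAt_comp {V : Type*} [NormedAddCommGroup V]
    [NormedSpace ℝ V] {f : V → ℝ} (hf : LocallyLipschitz f) {γ : ℝ → V} {y : V} {D : ℝ}
    (hγ : HasDerivAt γ y 0) (hD : HasDerivAt (fun t => f (γ t)) D 0) :
    Tendsto (fun t : ℝ => (1 / t) * (f (γ 0 + t • y) - f (γ 0))) (𝓝[>] 0) (𝓝 D) := by
  obtain ⟨L, s, hs, hL⟩ := hf (γ 0)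
  have hle : 𝓝[>] (0 : ℝ) ≤ 𝓝[≠] 0 := nhdsWithin_mono _ fun t ht => ne_of_gt ht
  have h1 := (hasDerivAt_iff_tendsto_slope_zero.1 hD).mono_left hle
  have h2 := (hasDerivAt_iff_tendsto_slope_zero.1 hγ).mono_left hle
  simp only [zero_add, smul_eq_mul] at h1 h2
  have h3 : Tendsto (fun t : ℝ => L * ‖y - t⁻¹ • (γ t - γ 0)‖) (𝓝[>] 0) (𝓝 0) := by
    simpa using ((tendsto_const_nhds (x := y)).sub h2).norm.const_mul (L : ℝ)
  have hl : Tendsto (fun t : ℝ => γ 0 + t • y) (𝓝[>] 0) (𝓝 (γ 0)) := by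
    have : ContinuousAt (fun t : ℝ => γ 0 + t • y) 0 := by fun_prop
    simpa using this.tendsto.mono_left nhdsWithin_le_nhds
  have h4 : Tendsto (fun t : ℝ => (1 / t) * (f (γ 0 + t • y) - f (γ t))) (𝓝[>] 0) (𝓝 0) := by
    refine squeeze_zero_norm' ?_ h3
    filter_upwards [hl.eventually hs, (hγ.continuousAt.tendsto.mono_left
      nhdsWithin_le_nhds).eventually hs, self_mem_nhdsWithin] with t ht1 ht2 ht0
    have ht0 : 0 < t := ht0
    have h5 := hL.norm_sub_le ht1 ht2
    have h6 : y - t⁻¹ • (γ t - γ 0) = t⁻¹ • (γ 0 + t • y - γ t) := by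
      rw [smul_sub, smul_sub, smul_add, smul_smul, inv_mul_cancel₀ ht0.ne', one_smul]
      abel
    rw [h6, norm_mul, norm_smul, one_div, norm_inv, Real.norm_of_nonneg ht0.le]
    have := mul_le_mul_of_nonneg_left h5 (inv_nonneg.2 ht0.le)
    linarith
  -- Replacing `γ t` by its tangent changes the difference quotient by `o(1)`.
  have h7 := h4.add h1
  rw [zero_add] at h7
  exact h7.congr fun t => by ring

section Manifold

variable {X : Type*} [NormedAddCommGroup X] [InnerProductSpace ℝ X] [FiniteDimensional ℝ X]

/-- Sharpness of `f` along `M`. At `p = Φ u`, the velocity `y = -Φ'(u) u` of the curve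
`t ↦ Φ (u - t u)`, which runs in `M` towards `xbar`, is a direction of quadratic descent. By
regularity the directional derivative dominates `⟪w, y⟫` for every subgradient `w` at `p`. -/
theorem GrowsRobustly.exists_norm_subgradient_ge {f : X → ℝ} (hf : LocallyLipschitz f) {M : Set X}
    {xbar : X} (hM : IsC2ManifoldAround M xbar) (hrob : GrowsRobustly f M xbar) :
    ∃ β > 0, ∀ᶠ p in 𝓝 xbar, p ∈ M → ∀ w ∈ clarkeSubdifferential f p, β * ‖p - xbar‖ ≤ ‖w‖ := by
  obtain ⟨E, G, Φ, hS⟩ := hM.exists_isStraightening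
  obtain ⟨δ, hδ, hgrow⟩ := hrob.quadratic_growth
  obtain ⟨h, hh, hfh⟩ := hrob.smooth_restriction
  rw [eventually_nhdsWithin_iff] at hfh
  have hΦt : Tendsto Φ (𝓝 0) (𝓝 xbar) := by
    simpa [hS.symm_zero] using hS.strict_symm.continuousAt.tendsto
  have hkC : ContDiffAt ℝ 2 (h ∘ Φ) 0 :=
    ContDiffAt.comp 0 (by rwa [hS.symm_zero]) hS.contDiffAt_symm
  obtain ⟨ρ, hρ, hΦ⟩ := hS.strict_symm.exists_forall_norm_sub_le (one_half_pos (α := ℝ))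
  have hclose : ∀ᶠ v in 𝓝 (0 : X), ‖Φ v - xbar - v‖ ≤ 1 / 2 * ‖v‖ := by
    filter_upwards [ball_mem_nhds 0 hρ] with v hv
    simpa [hS.symm_zero] using hΦ v hv 0 (mem_ball_self hρ)
  have heq : ∀ᶠ v in 𝓝 (0 : X), v ∈ E → f (Φ v) = h (Φ v) := by
    filter_upwards [hΦt.eventually hfh, hS.symm_mem] with v hv hvM hvE
    exact hv (hvM hvE)
  have hkgrow : ∀ᶠ v in 𝓝 (0 : X), v ∈ E → δ / 8 * ‖v‖ ^ 2 ≤ (h ∘ Φ) v - (h ∘ Φ) 0 := by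
    filter_upwards [hclose, heq, hΦt.eventually hgrow] with v hv1 hv2 hv3 hvE
    have h0 := heq.self_of_nhds E.zero_mem
    rw [Function.comp_apply, Function.comp_apply, ← hv2 hvE, ← h0, hS.symm_zero]
    refine le_trans ?_ hv3
    have h1 : 1 / 2 * ‖v‖ ≤ ‖Φ v - xbar‖ := by
      have := norm_sub_le (Φ v - xbar) (Φ v - xbar - v)
      rw [sub_sub_cancel] at this
      linarith
    have h2 := pow_le_pow_left₀ (by positivity) h1 2
    nlinarith
  have hk := hkC.eventually_le_fderiv_of_growth (by positivity) hkgrow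
  have hkd : ∀ᶠ v in 𝓝 (0 : X), DifferentiableAt ℝ (h ∘ Φ) v :=
    (hkC.eventually (by simp)).mono fun v hv => hv.differentiableAt (by norm_num)
  have hΦd : ∀ᶠ v in 𝓝 (0 : X), DifferentiableAt ℝ Φ v :=
    (hS.contDiffAt_symm.eventually (by simp)).mono fun v hv => hv.differentiableAt (by norm_num)
  have hΦn : ∀ᶠ v in 𝓝 (0 : X), ‖fderiv ℝ Φ v‖ < 2 := by
    have hc : ContinuousAt (fderiv ℝ Φ) 0 :=
      (hS.contDiffAt_symm.fderiv_right (m := 1) (by norm_num)).continuousAt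
    refine hc.norm.eventually_lt_const ?_
    simp only [hS.strict_symm.hasFDerivAt.fderiv]
    exact ContinuousLinearMap.norm_id_le.trans_lt one_lt_two
  have hGt : Tendsto G (𝓝 xbar) (𝓝 0) := by
    simpa [hS.map_base] using hS.strict.continuousAt.tendsto
  refine ⟨δ / 32, by positivity, ?_⟩
  filter_upwards [hS.left_inv, hS.map_mem, hGt.eventually hclose, hGt.eventually hk,
    hGt.eventually hkd, hGt.eventually hΦd, hGt.eventually hΦn,
    hGt.eventually heq.eventually_nhds] with p hinv hpE hcl hkp hkdp hΦdp hΦnp heqp hpM w hw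
  have huE := hpE hpM
  set u := G p with hu
  have hline : HasDerivAt (fun t : ℝ => u - t • u) (-u) 0 := by
    simpa using ((hasDerivAt_id (0 : ℝ)).smul_const u).const_sub u
  have hbase : u - (0 : ℝ) • u = u := by simp
  have hγ : HasDerivAt (fun t : ℝ => Φ (u - t • u)) (-(fderiv ℝ Φ u u)) 0 := by
    have h1 : HasFDerivAt Φ (fderiv ℝ Φ u) (u - (0 : ℝ) • u) := by
      rw [hbase]; exact hΦdp.hasFDerivAt
    exact (h1.comp_hasDerivAt 0 hline).congr_deriv (by simp)
  have hD : HasDerivAt (fun t : ℝ => f (Φ (u - t • u))) (-(fderiv ℝ (h ∘ Φ) u u)) 0 := by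
    have h1 : HasFDerivAt (h ∘ Φ) (fderiv ℝ (h ∘ Φ) u) (u - (0 : ℝ) • u) := by
      rw [hbase]; exact hkdp.hasFDerivAt
    have h2 : HasDerivAt (fun t : ℝ => (h ∘ Φ) (u - t • u)) (-(fderiv ℝ (h ∘ Φ) u u)) 0 := by
      have h3 := h1.comp_hasDerivAt 0 hline
      rw [map_neg] at h3
      exact h3
    refine h2.congr_of_eventuallyEq ?_
    have ht : Tendsto (fun t : ℝ => u - t • u) (𝓝 0) (𝓝 u) := by
      simpa using hline.continuousAt.tendsto
    filter_upwards [ht.eventually heqp] with t ht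
    exact ht (E.sub_mem huE (E.smul_mem t huE))
  have hdir := hf.tendsto_slope_of_hasDerivAt_comp hγ hD
  simp only [hbase, hinv] at hdir
  have hval := tendsto_nhds_unique hdir (hrob.regular p hpM _)
  have hle := inner_le_clarkeDirDeriv hf hw (-(fderiv ℝ Φ u u))
  rw [← hval, inner_neg_right] at hle
  have h1 := real_inner_le_norm w (fderiv ℝ Φ u u)
  have h2 : ‖fderiv ℝ Φ u u‖ ≤ 2 * ‖u‖ := ContinuousLinearMap.le_of_opNorm_le _ hΦnp.le u
  have h3 := mul_le_mul_of_nonneg_left h2 (norm_nonneg w)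
  have h4 := hkp huE
  have h5 : δ / 16 * ‖u‖ ≤ ‖w‖ := by
    rcases (norm_nonneg u).eq_or_lt with h0 | h0
    · rw [← h0, mul_zero]; exact norm_nonneg w
    · refine le_of_mul_le_mul_right ?_ h0
      nlinarith
  have h6 : ‖p - xbar‖ ≤ 2 * ‖u‖ := by
    rw [hinv] at hcl
    have := norm_add_le (p - xbar - u) u
    rw [sub_add_cancel] at this
    linarith [norm_nonneg u]
  nlinarith

end Manifold

/-! ### Goldstein subgradients near the manifold and away from it -/

section Goldstein

variable {X : Type*} [NormedAddCommGroup X] [InnerProductSpace ℝ X] [FiniteDimensional ℝ X]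

theorem goldsteinSubdifferential_subset {f : X → ℝ} {ε : ℝ} {x : X} {s : Set X}
    (hs : Convex ℝ s) (h : ∀ y ∈ closedBall x ε, clarkeSubdifferential f y ⊆ s) :
    goldsteinSubdifferential f ε x ⊆ s :=
  convexHull_min (Set.iUnion₂_subset h) hs

/-- If the radius is small relative to the distance to `M`, all subgradients involved aim away
from one nearest point of the centre, so their convex combinations are bounded below. -/
theorem GrowsRobustly.exists_norm_goldstein_ge {f : X → ℝ} (hf : LocallyLipschitz f) {M : Set X}
    {xbar : X} (hM : IsC2ManifoldAround M xbar) (hrob : GrowsRobustly f M xbar) :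
    ∃ c > 0, ∃ m > 0, ∀ᶠ x in 𝓝 xbar, ∀ ε < ‖x - xbar‖, ε < c * infDist x M → 0 ≤ ε →
      ∀ g ∈ goldsteinSubdifferential f ε x, m ≤ ‖g‖ := by
  obtain ⟨E, G, Φ, hS⟩ := hM.exists_isStraightening
  obtain ⟨μ, hμ, haim⟩ := hrob.aiming
  obtain ⟨L, t, ht, hL⟩ := hf xbar
  have hL0 : (0 : ℝ) ≤ L := L.2
  -- The factor `L + 1` stands in for `L`, which may vanish.
  obtain ⟨r, hr, hproj⟩ := hS.exists_norm_sub_le (η := μ / (12 * (L + 1))) (by positivity)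
  obtain ⟨R, hR, H⟩ := Metric.eventually_nhds_iff_ball.1
    ((eventually_mem_set.2 (ball_mem_nhds xbar hr)).and
      (haim.and (hM.eventually_exists_isNearestPoint.and (eventually_mem_nhds_iff.2 ht))))
  -- `c` and the `η` above are such that the errors `ε (μ + 2 L)` from moving `x` to `y` and
  -- `3 L η d_M(x)` from moving the nearest point each cost at most a quarter of `μ d_M(x)`.
  set c := μ / (4 * (μ + 2 * L)) with hc
  have hc0 : 0 < c := by positivity
  have hcμ : c * (μ + 2 * L) = μ / 4 := by rw [hc]; field_simp
  have hc1 : c ≤ 1 := by nlinarith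
  have hη : L * (μ / (12 * (L + 1)) * 3) ≤ μ / 4 := by
    rw [show (L : ℝ) * (μ / (12 * (L + 1)) * 3) = μ / 4 * (L / (L + 1)) by field_simp; ring]
    exact mul_le_of_le_one_right (by positivity) (div_le_one_of_le₀ (by linarith) (by positivity))
  refine ⟨c, hc0, μ / 2, half_pos hμ, ?_⟩
  filter_upwards [ball_mem_nhds xbar (show 0 < R / 4 by positivity)] with x hx ε hεx hεc hε0 g hg
  rw [mem_ball, dist_eq_norm] at hx
  obtain ⟨p, hp⟩ := (H x (by rw [mem_ball, dist_eq_norm]; linarith)).2.2.1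
  have hp_near : p ∈ ball xbar R := by
    have := hp.dist_le_two_mul hM.1
    rw [dist_eq_norm x] at this
    rw [mem_ball]
    linarith
  have hd0 : 0 < infDist x M := by
    by_contra! hcon
    nlinarith
  have hsub : goldsteinSubdifferential f ε x ⊆ {v | μ / 2 * infDist x M ≤ inner ℝ (x - p) v} := by
    refine goldsteinSubdifferential_subset ?_ ?_
    · exact convex_halfSpace_ge (innerₛₗ ℝ (x - p)).isLinear _
    intro y hy v hv
    rw [mem_closedBall, dist_eq_norm] at hy
    have hy_near : ‖y - xbar‖ < R / 2 := by
      have := norm_add_le (y - x) (x - xbar)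
      rw [sub_add_sub_cancel] at this
      linarith
    obtain ⟨-, haimy, ⟨q, hq⟩, hyt⟩ := H y (by rw [mem_ball, dist_eq_norm]; linarith)
    have hq_near : q ∈ ball xbar R := by
      have := hq.dist_le_two_mul hM.1
      rw [dist_eq_norm y] at this
      rw [mem_ball]
      linarith
    have hvL : ‖v‖ ≤ L := norm_le_of_mem_clarkeSubdifferential hL hyt hv
    have ha := haimy q hq v hv
    have hqp := hproj x y p q (H p hp_near).1 (H q hq_near).1 hp hq
    have hdy1 : infDist y M ≤ infDist x M + ε := by
      have := infDist_le_infDist_add_dist (s := M) (x := y) (y := x)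
      rw [dist_eq_norm] at this
      linarith
    have hdy2 : infDist x M ≤ infDist y M + ε := by
      have := infDist_le_infDist_add_dist (s := M) (x := x) (y := y)
      rw [dist_comm, dist_eq_norm] at this
      linarith
    have hεd : ε ≤ infDist x M := by nlinarith
    have hη0 : 0 ≤ μ / (12 * (L + 1)) := by positivity
    have hqp' : ‖q - p‖ ≤ μ / (12 * (L + 1)) * 3 * infDist x M + ε := by nlinarith
    have hin : inner ℝ (x - p) v = inner ℝ v (y - q) - inner ℝ v ((y - x) - (q - p)) := by
      rw [← inner_sub_right, real_inner_comm]
      congr 1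
      abel
    have h1 : inner ℝ v ((y - x) - (q - p))
        ≤ L * (2 * ε + μ / (12 * (L + 1)) * 3 * infDist x M) := by
      refine (real_inner_le_norm _ _).trans (mul_le_mul hvL ?_ (norm_nonneg _) hL0)
      have := norm_sub_le (y - x) (q - p)
      linarith
    have h2 := mul_le_mul_of_nonneg_right hη hd0.le
    have h3 : ε * (μ + 2 * L) ≤ μ / 4 * infDist x M := by
      have := mul_le_mul_of_nonneg_right hεc.le (show 0 ≤ μ + 2 * (L : ℝ) by positivity)
      rw [mul_right_comm, hcμ] at this
      exact this
    rw [Set.mem_ofPred_eq, hin]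
    nlinarith
  have h1 := (hsub hg).trans (real_inner_le_norm (x - p) g)
  rw [hp.norm_sub_eq, mul_comm (infDist x M)] at h1
  exact le_of_mul_le_mul_right h1 hd0

/-- If the radius is comparable to the distance to `M`, the Goldstein subgradients are close to
subgradients at the nearest point, whose norms grow linearly along `M`. -/
theorem GrowsRobustly.exists_norm_sub_le_mul {f : X → ℝ} (hf : LocallyLipschitz f) {M : Set X}
    {xbar : X} (hM : IsC2ManifoldAround M xbar) (hrob : GrowsRobustly f M xbar) {c : ℝ}
    (hc : 0 < c) :
    ∃ C > 0, ∀ᶠ x in 𝓝 xbar, ∀ ε < ‖x - xbar‖, c * infDist x M ≤ ε →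
      ∀ g ∈ goldsteinSubdifferential f ε x, ‖g‖ ≤ ε → ‖x - xbar‖ ≤ C * ε := by
  obtain ⟨β, hβ, hsharp⟩ := hrob.exists_norm_subgradient_ge hf hM
  obtain ⟨K, hK, U, hU, hlip⟩ := hrob.upper_lipschitz
  obtain ⟨R, hR, H⟩ := Metric.eventually_nhds_iff_ball.1
    (hsharp.and ((eventually_mem_set.2 hU).and hM.eventually_exists_isNearestPoint))
  refine ⟨1 / c + (1 + K * (1 / c + 1)) / β, by positivity, ?_⟩
  filter_upwards [ball_mem_nhds xbar (show 0 < R / 4 by positivity)] with x hx ε hεx hεc g hg hgε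
  rw [mem_ball, dist_eq_norm] at hx
  obtain ⟨p, hp⟩ := (H x (by rw [mem_ball, dist_eq_norm]; linarith)).2.2
  have hp_near : p ∈ ball xbar R := by
    have := hp.dist_le_two_mul hM.1
    rw [dist_eq_norm x] at this
    rw [mem_ball]
    linarith
  obtain ⟨hsharp_p, hpU, -⟩ := H p hp_near
  have hxp : ‖x - p‖ ≤ 1 / c * ε := by
    rw [hp.norm_sub_eq, one_div, inv_mul_eq_div, le_div_iff₀ hc]
    linarith
  have hsub : goldsteinSubdifferential f ε x ⊆
      clarkeSubdifferential f p + closedBall (0 : X) (K * ((1 / c + 1) * ε)) := by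
    refine goldsteinSubdifferential_subset
      ((convex_clarkeSubdifferential f p).add (convex_closedBall _ _)) fun y hy => ?_
    rw [mem_closedBall, dist_eq_norm] at hy
    have hyU : y ∈ U := by
      refine (H y ?_).2.1
      have := norm_add_le (y - x) (x - xbar)
      rw [sub_add_sub_cancel] at this
      rw [mem_ball, dist_eq_norm]
      linarith
    refine (hlip p ⟨hpU, hp.1⟩ y hyU).trans
      (Set.add_subset_add_left (closedBall_subset_closedBall ?_))
    refine mul_le_mul_of_nonneg_left ?_ hK.le
    have := norm_add_le (y - x) (x - p)
    rw [sub_add_sub_cancel, norm_sub_rev] at this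
    linarith
  obtain ⟨w, hw, b, hb, hwb⟩ := Set.mem_add.1 (hsub hg)
  rw [mem_closedBall_zero_iff] at hb
  have hwn : ‖w‖ ≤ ‖g‖ + ‖b‖ := by
    have := norm_sub_le g b
    rwa [← hwb, add_sub_cancel_right, hwb] at this
  have h1 := hsharp_p hp.1 w hw
  have h2 : ‖p - xbar‖ ≤ (1 + K * (1 / c + 1)) / β * ε := by
    rw [div_mul_eq_mul_div, le_div_iff₀ hβ]
    linarith
  have h3 := norm_add_le (x - p) (p - xbar)
  rw [sub_add_sub_cancel] at h3
  linarith

/-- The infimum defining the modulus is over a nonempty set once `f` has a Clarke critical point,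
because then `0` is a Goldstein subgradient for every large enough radius. -/
theorem le_goldsteinModulus {f : X → ℝ} {z x : X} (hz : 0 ∈ clarkeSubdifferential f z) {a : ℝ}
    (h : ∀ ε, 0 ≤ ε → ∀ g ∈ goldsteinSubdifferential f ε x, ‖g‖ ≤ ε → a ≤ ε) :
    a ≤ goldsteinModulus f x := by
  refine le_csInf ⟨dist z x, dist_nonneg, 0, ⟨?_, fun v _ => by simp⟩, by simp⟩ ?_
  · exact subset_convexHull ℝ _ (Set.mem_biUnion (mem_closedBall.2 le_rfl) hz)
  · rintro ε ⟨hε, g, hg, hgε⟩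
    exact h ε hε g hg.1 hgε

end Goldstein

theorem mainTheorem1 {X : Type*} [NormedAddCommGroup X] [InnerProductSpace ℝ X]
    [FiniteDimensional ℝ X] (f : X → ℝ) (hf : LocallyLipschitz f) (M : Set X) (xbar : X)
    (hM : IsC2ManifoldAround M xbar) (hrob : GrowsRobustly f M xbar) :
    GoldsteinModulusGrowsLinearly f xbar := by
  have hmin : IsLocalMin f xbar := by
    obtain ⟨δ, hδ, h⟩ := hrob.quadratic_growth
    filter_upwards [h] with x hx
    have : 0 ≤ δ / 2 * ‖x - xbar‖ ^ 2 := by positivity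
    linarith
  have hcrit := zero_mem_clarkeSubdifferential hf (hrob.regular xbar hM.1) hmin
  obtain ⟨c, hc, m, hm, hfar⟩ := hrob.exists_norm_goldstein_ge hf hM
  obtain ⟨C, hC, hnear⟩ := hrob.exists_norm_sub_le_mul hf hM hc
  refine ⟨1 / (C + 1), by positivity, ?_⟩
  filter_upwards [hfar, hnear, ball_mem_nhds xbar hm] with x hfx hnx hxm
  rw [mem_ball, dist_eq_norm] at hxm
  refine le_goldsteinModulus hcrit fun ε hε g hg hgε => ?_
  rw [one_div, inv_mul_eq_div, div_le_iff₀ (by positivity)]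
  by_cases hεx : ε < ‖x - xbar‖
  · by_cases hεc : ε < c * infDist x M
    · linarith [hfx ε hεx hεc hε g hg]
    · linarith [hnx ε hεx (not_lt.1 hεc) g hg hgε]
  -- For `ε ≥ ‖x - xbar‖` the bound is immediate, as `C + 1 ≥ 1`.
  · nlinarith
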